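/- A \emph{ladder system} on $\omega_1$ is a sequence $\mathbf C=(C_\alpha)_{\alpha\in\lim\omega_1}$, indexed by the (nonzero) countable limit ordinals, such that each $C_\alpha$ is a cofinal subset of $\alpha$ of order type $\omega$. An \emph{$\omega$-colouring} of $\mathbf C$ is a sequence $\mathbf f=(f_\alpha)_{\alpha\in\lim\omega_1}$ of maps $f_\alpha:C_\alpha\to\omega$. An \emph{$\omega_1$-uniformization} of $\mathbf f$ is a function $\varphi:\omega_1\to\omega$ such that, for every $\alpha\in\lim\omega_1$, $\varphi(\xi)=f_\alpha(\xi)$ for all but finitely many $\xi\in C_\alpha$. A \emph{Suslin tree} is a tree of height $\omega_1$ (a partially ordered set in which the predecessors of each node are well ordered) with countable levels and with no uncountable chains and no uncountable antichains. A set $D\subseteq\omega_1$ is \emph{$\mathbf C$-closed} if $C_\alpha\cap C_\beta\subseteq D$ for all distinct $\alpha,\beta\in D\cap\lim\omega_1$. Let $\mathbf C$ be a ladder system on $\omega_1$ and $\mathbf f$ an $\omega$-colouring of $\mathbf C$. Let $\mathcal P_{\mathbf f}$ be the set of all finite partial maps $p$ from $\omega_1$ to $\omega$ whose domain $D^p$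 is $\mathbf C$-closed, ordered by: $q\le p$ if and only if $q\supseteq p$ and $q(\xi)=f_\alpha(\xi)$ for all $\alpha\in D^p\cap\lim\omega_1$ and all $\xi\in C_\alpha\cap(D^q\setminus D^p)$. \textbf{Theorem.} The poset $\mathcal P_{\mathbf f}$ is ccc and has cardinality $\aleph_1$. Moreover, \begin{enumerate} \item $\Vdash_{\mathcal P_{\mathbf f}}$ there is an $\omega_1$-uniformization of $\mathbf f$, and \item if $R$ is a Suslin tree (in the ground model), then $\Vdash_{\mathcal P_{\mathbf f}}$ $\check R$ is a Suslin tree. \end{enumerate} -/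

import Mathlib

open Cardinal Ordinal

/-! ### Ladder systems and their colourings -/

/-- The set `ω₁` of countable ordinals, as a well-ordered type. -/
abbrev Omega1 : Type := Ordinal.ToType (ω_ 1)

/-- The (nonzero) countable limit ordinals. -/
abbrev LimOmega1 : Type := {α : Omega1 // Order.IsSuccLimit α}

/-- A ladder system on `ω₁`: each `C α` is a cofinal subset of the limit ordinal `α`,
of order type `ω`. -/
structure LadderSystem where
  ladder : LimOmega1 → Set Omega1
  subset : ∀ α, ladder α ⊆ Set.Iio α.1
  cofinal : ∀ α, ∀ β < α.1, ∃ γ ∈ ladder α, β ≤ γ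
  type_omega : ∀ α, Nonempty (ℕ ≃o ladder α)

/-- An `ω`-colouring of `C`: a sequence of maps `f α : C α → ω`. -/
abbrev LadderSystem.Colouring (C : LadderSystem) : Type :=
  (α : LimOmega1) → C.ladder α → ℕ

/-- `D ⊆ ω₁` is `C`-closed: `C α ∩ C β ⊆ D` for all distinct limit ordinals `α, β ∈ D`. -/
def LadderSystem.IsClosedSet (C : LadderSystem) (D : Set Omega1) : Prop :=
  ∀ α β : LimOmega1, α.1 ∈ D → β.1 ∈ D → α ≠ β → C.ladder α ∩ C.ladder β ⊆ D

/-! ### The poset of finite maps on `C`-closed sets -/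

/-- A condition of the poset `P_f`: a finite partial map `p` from `ω₁` to `ω` (with `none` for
undefined) whose domain is `C`-closed. The colouring only enters the ordering. -/
@[ext]
structure UniformizingPoset (C : LadderSystem) (f : C.Colouring) : Type where
  map : Omega1 → Option ℕ
  finite_dom : {ξ | map ξ ≠ none}.Finite
  closed_dom : C.IsClosedSet {ξ | map ξ ≠ none}

namespace UniformizingPoset

variable {C : LadderSystem} {f : C.Colouring}

/-- The domain of a condition. -/
def dom (p : UniformizingPoset C f) : Set Omega1 := {ξ | p.map ξ ≠ none}

/-- `q ≤ p` if `q` extends `p` as a map and, for each limit `α ∈ dom p` and each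
`ξ ∈ C α ∩ (dom q \ dom p)`, we have `q ξ = f α ξ`. -/
instance : PartialOrder (UniformizingPoset C f) where
  le q p := (∀ ξ n, p.map ξ = some n → q.map ξ = some n) ∧
    ∀ α : LimOmega1, α.1 ∈ p.dom → ∀ ξ : C.ladder α, ξ.1 ∈ q.dom → ξ.1 ∉ p.dom →
      q.map ξ.1 = some (f α ξ)
  le_refl p := ⟨fun _ _ h => h, fun _ _ _ h h' => absurd h h'⟩
  le_trans := by
    rintro r q p ⟨h1, h2⟩ ⟨h3, h4⟩
    refine ⟨fun ξ n h => h1 ξ n (h3 ξ n h), fun α hα ξ hr hp => ?_⟩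
    by_cases hq : ξ.1 ∈ q.dom
    · exact h1 _ _ (h4 α hα ξ hq hp)
    · refine h2 α ?_ ξ hr hq
      obtain ⟨n, hn⟩ := Option.ne_none_iff_exists'.mp hα
      have := h3 _ _ hn
      simp [dom, this]
  le_antisymm := by
    rintro p q ⟨h1, -⟩ ⟨h2, -⟩
    apply UniformizingPoset.ext
    funext ξ
    apply Option.ext
    intro n
    exact ⟨h2 ξ n, h1 ξ n⟩

end UniformizingPoset

/-- The countable chain condition: every set of pairwise incompatible conditions is countable. -/
def IsCCC (P : Type*) [PartialOrder P] : Prop :=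
  ∀ A : Set P, (∀ p ∈ A, ∀ q ∈ A, p ≠ q → ¬ ∃ r, r ≤ p ∧ r ≤ q) → A.Countable

/-! ### Suslin trees -/

/-- The node `t` has height `α`: the set of predecessors of `t` has order type `α`. -/
def HasHeight {R : Type*} [PartialOrder R] (t : R) (α : Omega1) : Prop :=
  Nonempty (Set.Iio t ≃o Set.Iio α)

/-- A Suslin tree: a tree of height `ω₁` with countable levels, and with neither uncountable chains
nor uncountable antichains. -/
structure IsSuslinTree (R : Type*) [PartialOrder R] : Prop where
  /-- `R` is a tree: the sets of predecessors are well-ordered. -/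
  wellOrdered : ∀ t : R, IsWellOrder (Set.Iio t) (· < ·)
  /-- `R` has height `ω₁`: all heights are countable, and they take all countable values. -/
  height_lt : ∀ t : R, ∃ α, HasHeight t α
  level_nonempty : ∀ α, ∃ t : R, HasHeight t α
  level_countable : ∀ α, {t : R | HasHeight t α}.Countable
  chain_countable : ∀ A : Set R, IsChain (· ≤ ·) A → A.Countable
  antichain_countable : ∀ A : Set R, IsAntichain (· ≤ ·) A → A.Countable

/-! ### Forcing

Smaller conditions are stronger. Each subset, in the generic extension, of a ground-model set `X`
has a name that is a subset of `X̌ × P`; so the sentences below, which speak about elements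
and subsets of ground-model sets in the extension, are formulated with such names.
A sentence of the forcing language is identified with the relation "`p ⊩ φ`", which is defined by
the usual recursion on the formation of `φ` (atomic sentences, `¬`, `∧`, `∀`;
the connectives `→`, `∃` are defined from these). -/

namespace Forcing

/-- A `P`-name for a subset of the ground-model set `X`: a set of pairs `(x̌, a)`. -/
abbrev Name (P X : Type*) := Set (X × P)

/-- A sentence of the forcing language, given by the set of all conditions which force it. -/
abbrev Sentence (P : Type*) := P → Prop

section

variable {P : Type*} [PartialOrder P] {X Y I : Type*}

/-- `⊩_P φ`: every condition forces `φ`. -/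
def Forced (φ : Sentence P) : Prop := ∀ p, φ p

/-- A quantifier-free statement about ground-model elements (equality, order):
it is forced by `p` if and only if it is true. -/
def truth (a : Prop) : Sentence P := fun _ => a

/-- `p ⊩ x̌ ∈ A`: the set of all `r` which lie below some `a` with `(x̌, a) ∈ A` is dense
below `p`. -/
def mem (x : X) (A : Name P X) : Sentence P :=
  fun p => ∀ q ≤ p, ∃ r ≤ q, ∃ a, (x, a) ∈ A ∧ r ≤ a

/-- `p ⊩ ¬φ`: no `q ≤ p` forces `φ`. -/
def neg (φ : Sentence P) : Sentence P := fun p => ∀ q ≤ p, ¬ φ q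

/-- `p ⊩ φ ∧ ψ`. -/
def and (φ ψ : Sentence P) : Sentence P := fun p => φ p ∧ ψ p

/-- `p ⊩ ∀ i, φ i`, where `i` ranges either over the elements of a ground-model set or over
all names for subsets of a ground-model set. -/
def all (φ : I → Sentence P) : Sentence P := fun p => ∀ i, φ i p

/-- `φ → ψ` is `¬(φ ∧ ¬ψ)`. -/
def imp (φ ψ : Sentence P) : Sentence P := neg (and φ (neg ψ))

/-- `∃ i, φ i` is `¬∀ i, ¬φ i`. -/
def ex (φ : I → Sentence P) : Sentence P := neg (all fun i => neg (φ i))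

/-- The canonical name for the ground-model set `X`, as a subset of itself. -/
def check (P X : Type*) : Name P X := Set.univ

/-- "`F` is an injective function from `A` to `ω`", for names `A ⊆ X` and `F ⊆ X × ω`. -/
def isInjectionToOmega (A : Name P X) (F : Name P (X × ℕ)) : Sentence P :=
  and (all fun x => all fun n => imp (mem (x, n) F) (mem x A)) <|
  and (all fun x => imp (mem x A) (ex fun n : ℕ => mem (x, n) F)) <|
  and (all fun x => all fun m => all fun n =>
    imp (and (mem (x, m) F) (mem (x, n) F)) (truth (m = n)))
  (all fun x => all fun y => all fun n =>
    imp (and (mem (x, n) F) (mem (y, n) F)) (truth (x = y)))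

/-- "`A` is countable", for a name `A` of a subset of `X`. -/
def countable (A : Name P X) : Sentence P :=
  ex fun F : Name P (X × ℕ) => isInjectionToOmega A F

/-- "The ordinal `ω₁` of the ground model is still uncountable", that is, it is the `ω₁` of the
extension. -/
def omega1Preserved : Sentence P := neg (countable (check P Omega1))

/-- "`φ` is an `ω₁`-uniformization of `f`": `φ` is a function from `ω₁` to `ω` and, for each limit
`α < ω₁`, there is a finite set `E` with `φ ξ = f α ξ` for all `ξ ∈ C α \ E`. (The finite subsets
of `ω₁` in the extension are those of the ground model.) -/
def isUniformization (C : LadderSystem) (f : C.Colouring) (φ : Name P (Omega1 × ℕ)) : Sentence P :=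
  and (all fun ξ => ex fun n => mem (ξ, n) φ) <|
  and (all fun ξ => all fun m => all fun n =>
    imp (and (mem (ξ, m) φ) (mem (ξ, n) φ)) (truth (m = n)))
  (all fun α : LimOmega1 => ex fun E : Finset Omega1 => all fun ξ : C.ladder α =>
    imp (truth (ξ.1 ∉ E)) (mem (ξ.1, f α ξ) φ))

/-- "There is an `ω₁`-uniformization of `f`", where `ω₁` is the `ω₁` of the extension. -/
def hasUniformization (C : LadderSystem) (f : C.Colouring) : Sentence P :=
  and omega1Preserved (ex fun φ : Name P (Omega1 × ℕ) => isUniformization C f φ)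

variable {R : Type*} [PartialOrder R]

/-- "`F` is an order isomorphism from the set of predecessors of `t` in `R` to the ordinal `α`". -/
def isHeightIso (t : R) (α : Omega1) (F : Name P (R × Omega1)) : Sentence P :=
  and (all fun s => all fun β => imp (mem (s, β) F) (truth (s < t ∧ β < α))) <|
  and (all fun s => imp (truth (s < t)) (ex fun β => mem (s, β) F)) <|
  and (all fun β => imp (truth (β < α)) (ex fun s => mem (s, β) F))
  (all fun s => all fun s' => all fun β => all fun β' =>
    imp (and (mem (s, β) F) (mem (s', β') F)) (truth (s ≤ s' ↔ β ≤ β')))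

/-- "The node `t` of `R` has height `α`". -/
def hasHeight (t : R) (α : Omega1) : Sentence P :=
  ex fun F : Name P (R × Omega1) => isHeightIso t α F

/-- "`R` is a tree": each nonempty set of predecessors of a node has a least element. -/
def isTree (P R : Type*) [PartialOrder P] [PartialOrder R] : Sentence P :=
  all fun t : R => all fun A : Name P R =>
    imp (and (all fun s => imp (mem s A) (truth (s < t))) (ex fun s => mem s A))
      (ex fun s => and (mem s A) (all fun u => imp (mem u A) (truth (s ≤ u))))

/-- "`R` has height `ω₁`": the heights of the nodes of `R` are exactly the elements of `ω₁`. -/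
def heightOmega1 (P R : Type*) [PartialOrder P] [PartialOrder R] : Sentence P :=
  and omega1Preserved <|
  and (all fun t : R => ex fun α => hasHeight t α) (all fun α => ex fun t : R => hasHeight t α)

/-- "The levels of `R` are countable". -/
def levelsCountable (P R : Type*) [PartialOrder P] [PartialOrder R] : Sentence P :=
  all fun α => all fun L : Name P R =>
    imp (all fun t => imp (mem t L) (hasHeight t α)) (countable L)

/-- "Every chain of `R` is countable". -/
def chainsCountable (P R : Type*) [PartialOrder P] [PartialOrder R] : Sentence P :=
  all fun A : Name P R =>
    imp (all fun s => all fun t => imp (and (mem s A) (mem t A)) (truth (s ≤ t ∨ t ≤ s)))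
      (countable A)

/-- "Every antichain of `R` is countable". -/
def antichainsCountable (P R : Type*) [PartialOrder P] [PartialOrder R] : Sentence P :=
  all fun A : Name P R =>
    imp (all fun s => all fun t => imp (and (mem s A) (mem t A)) (truth (s ≠ t → ¬ s ≤ t)))
      (countable A)

/-- "`R` is a Suslin tree", for a partial order `R` of the ground model. -/
def isSuslinTree (P R : Type*) [PartialOrder P] [PartialOrder R] : Sentence P :=
  and (isTree P R) <| and (heightOmega1 P R) <| and (levelsCountable P R) <|
    and (chainsCountable P R) (antichainsCountable P R)

end

end Forcing

/-! Everything reduces to a strong chain condition, `exists_rel_and_compatible`. Let `p i` be an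
uncountable family of conditions and `rel` a relation such that every uncountable set of indices has
a countable subset that `rel`-dominates all but countably many of its members. Then some `p i`, `p
j` with `rel i j` are compatible. Taking `≠` for `rel` gives ccc and preserves `ω₁`. In a Suslin
tree, `<` and incomparability also qualify. An uncountable antichain or chain in the extension would
yield uncountably many conditions forcing nodes into it, hence two compatible ones whose nodes are
related in the wrong way.

For the chain condition, a condition leaves only a finite trace at or below `η`, so there are
countably many traces. At a closure point `δ` outside the finite domain of `p j`, everything `p j`
sees below `δ` is bounded by some `η < δ`. A suitable `p i` with the same trace at `η` has its
domain below `δ`, and the two do not interfere.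

The union of the generic filter uniformizes: once `α` is in the domain, all later values on its
ladder obey `f α`. Density holds because every finite set lies in a finite `C`-closed set. -/

/-! ### Countable ordinals: bounds and closure points -/

namespace Omega1

instance : Uncountable Omega1 := by
  rw [← Cardinal.aleph0_lt_mk_iff]
  simp

theorem countable_Iio (η : Omega1) : (Set.Iio η).Countable := by
  rw [← Cardinal.le_aleph0_iff_set_countable, ← Order.lt_succ_iff, Cardinal.succ_aleph0]
  simpa using Cardinal.mk_Iio_lt η (by simp)

theorem countable_Iic (η : Omega1) : (Set.Iic η).Countable := by
  rw [← Set.Iio_union_right]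
  exact (countable_Iio η).union (Set.countable_singleton η)

theorem exists_forall_lt_of_countable {S : Set Omega1} (hS : S.Countable) :
    ∃ β, ∀ ξ ∈ S, ξ < β := by
  by_contra! h
  have : (Set.univ : Set Omega1) ⊆ ⋃ ξ ∈ S, Set.Iic ξ := by
    intro β _
    obtain ⟨ξ, hξ, hβ⟩ := h β
    exact Set.mem_biUnion hξ hβ
  exact Set.not_countable_univ ((hS.biUnion fun ξ _ => countable_Iic ξ).mono this)

/-- Every function on `ω₁` has arbitrarily large closure points. -/
theorem exists_closure_point (g : Omega1 → Omega1) (β : Omega1) :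
    ∃ δ, β < δ ∧ ∀ η < δ, g η < δ := by
  have key : ∀ x, ∃ y, x < y ∧ ∀ η ≤ x, g η < y := by
    intro x
    obtain ⟨y, hy⟩ := exists_forall_lt_of_countable
      ((Set.countable_singleton x).union ((countable_Iic x).image g))
    exact ⟨y, hy x (by simp), fun η hη => hy _ (Or.inr ⟨η, hη, rfl⟩)⟩
  choose h h1 h2 using key
  -- The least element of `U` is the supremum of the iterates, so anything below it lies below some
  -- iterate.
  let U : Set Omega1 := {δ | ∀ n : ℕ, h^[n] β < δ}
  have hU : U.Nonempty := by
    obtain ⟨δ, hδ⟩ := exists_forall_lt_of_countable (Set.countable_range fun n => h^[n] β)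
    exact ⟨δ, fun n => hδ _ ⟨n, rfl⟩⟩
  have hmem := wellFounded_lt.min_mem U hU
  refine ⟨wellFounded_lt.min U hU, hmem 0, fun η hη => ?_⟩
  have : η ∉ U := fun h' => wellFounded_lt.not_lt_min U h' hη
  obtain ⟨n, hn⟩ : ∃ n, η ≤ h^[n] β := by simpa [U] using this
  have := h2 _ _ hn
  rw [← Function.iterate_succ_apply' h] at this
  exact this.trans (hmem _)

theorem exists_bound_of_finite_of_lt {S : Set Omega1} (hS : S.Finite) {β δ : Omega1} (hβ : β < δ)
    (h : ∀ ξ ∈ S, ξ < δ) : ∃ η < δ, ∀ ξ ∈ S, ξ ≤ η := by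
  obtain ⟨η, hη, hmax⟩ := (hS.insert β).exists_maximal ⟨β, by simp⟩
  refine ⟨η, ?_, fun ξ hξ => le_of_not_gt fun hlt =>
    hlt.not_ge (hmax (Set.mem_insert_of_mem _ hξ) hlt.le)⟩
  rcases hη with rfl | hη
  exacts [hβ, h _ hη]

end Omega1

/-! ### Finite `C`-closed sets -/

namespace LadderSystem

variable (C : LadderSystem)

theorem finite_ladder_inter_Iic {α : LimOmega1} {η : Omega1} (h : η < α.1) :
    (C.ladder α ∩ Set.Iic η).Finite := by
  obtain ⟨γ, hγ, hle⟩ := C.cofinal α η h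
  obtain ⟨e⟩ := C.type_omega α
  refine ((Set.finite_Iic (e.symm ⟨γ, hγ⟩)).image fun n => (e n).1).subset ?_
  rintro ξ ⟨hξ, hξη⟩
  refine ⟨e.symm ⟨ξ, hξ⟩, ?_, by simp⟩
  simp only [Set.mem_Iic, map_le_map_iff, Subtype.mk_le_mk]
  exact le_trans hξη hle

theorem finite_ladder_inter {α β : LimOmega1} (h : α.1 < β.1) :
    (C.ladder α ∩ C.ladder β).Finite :=
  (C.finite_ladder_inter_Iic h).subset fun _ hξ => ⟨hξ.2, le_of_lt (Set.mem_Iio.mp (C.subset α hξ.1))⟩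

/-- Close off from the top down. Let `μ` be the largest element of `D` below `δ`, and add the
finitely many points its ladder shares with ladders of larger elements of `D`. The new points lie
below `μ`, so no pair already treated is disturbed and `μ` replaces `δ`; well-foundedness ends the
process. -/
theorem exists_finite_isClosedSet_of_closed_above (δ : Omega1) : ∀ D : Set Omega1, D.Finite →
    (∀ α β : LimOmega1, α.1 ∈ D → β.1 ∈ D → δ ≤ α.1 → α.1 < β.1 →
      C.ladder α ∩ C.ladder β ⊆ D) →
    ∃ K, D ⊆ K ∧ K.Finite ∧ C.IsClosedSet K := by
  induction δ using WellFoundedLT.induction with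
  | ind δ ih =>
    intro D hD hclosed
    rcases (D ∩ Set.Iio δ).eq_empty_or_nonempty with hemp | hne
    · refine ⟨D, subset_rfl, hD, fun α β hα hβ hne => ?_⟩
      have hge : ∀ γ ∈ D, δ ≤ γ := fun γ hγ => le_of_not_gt fun hlt =>
        (Set.ext_iff.mp hemp γ).mp ⟨hγ, hlt⟩
      rcases lt_or_gt_of_ne (fun h => hne (Subtype.ext h) : α.1 ≠ β.1) with h | h
      · exact hclosed α β hα hβ (hge _ hα) h
      · rw [Set.inter_comm]
        exact hclosed β α hβ hα (hge _ hβ) h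
    · obtain ⟨μ, ⟨hμD, hμδ⟩, hmax⟩ := (hD.inter_of_left (Set.Iio δ)).exists_maximal hne
      let N : Set Omega1 := ⋃ β ∈ D, {ξ | ∃ (hμ : Order.IsSuccLimit μ) (hβ : Order.IsSuccLimit β),
        μ < β ∧ ξ ∈ C.ladder ⟨μ, hμ⟩ ∩ C.ladder ⟨β, hβ⟩}
      have hN : N.Finite := by
        refine hD.biUnion fun β _ => ?_
        by_cases h : Order.IsSuccLimit μ ∧ Order.IsSuccLimit β ∧ μ < β
        · exact (C.finite_ladder_inter (α := ⟨μ, h.1⟩) (β := ⟨β, h.2.1⟩) h.2.2).subset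
            fun ξ ⟨_, _, _, hξ⟩ => hξ
        · exact Set.finite_empty.subset fun ξ ⟨h1, h2, h3, _⟩ => h ⟨h1, h2, h3⟩
      have hNlt : ∀ ξ ∈ N, ξ < μ := by
        intro ξ hξ
        obtain ⟨β, _, h1, h2, _, hξ⟩ := Set.mem_iUnion₂.mp hξ
        exact C.subset _ hξ.1
      obtain ⟨K, hK, h⟩ := ih μ hμδ (D ∪ N) (hD.union hN) (by
        rintro α β hα hβ hμα hαβ
        replace hα : α.1 ∈ D := hα.resolve_right fun h => (hNlt _ h).not_ge hμα
        replace hβ : β.1 ∈ D := hβ.resolve_right fun h => (hNlt _ h).not_ge (hμα.trans hαβ.le)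
        by_cases hδ : δ ≤ α.1
        · exact (hclosed α β hα hβ hδ hαβ).trans Set.subset_union_left
        · have : α.1 = μ := le_antisymm (hmax ⟨hα, not_le.mp hδ⟩ hμα) hμα
          subst this
          exact fun ξ hξ => Or.inr (Set.mem_biUnion hβ ⟨α.2, β.2, hαβ, hξ⟩))
      exact ⟨K, Set.subset_union_left.trans hK, h⟩

/-- Every finite set is contained in a finite `C`-closed set. -/
theorem exists_finite_isClosedSet {D : Set Omega1} (hD : D.Finite) :
    ∃ K, D ⊆ K ∧ K.Finite ∧ C.IsClosedSet K := by
  obtain ⟨δ, hδ⟩ := Omega1.exists_forall_lt_of_countable hD.countable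
  exact C.exists_finite_isClosedSet_of_closed_above δ D hD
    fun α _ hα _ hle => absurd hle (hδ _ hα).not_ge

/-- The graph of the colouring `f α`, as a set of pairs. -/
def Colouring.graph {C : LadderSystem} (f : C.Colouring) (α : LimOmega1) : Set (Omega1 × ℕ) :=
  {x | ∃ h : x.1 ∈ C.ladder α, f α ⟨x.1, h⟩ = x.2}

end LadderSystem

/-! ### Compatibility, traces and the chain condition -/

namespace UniformizingPoset

variable {C : LadderSystem} {f : C.Colouring}

theorem mem_dom_iff {p : UniformizingPoset C f} {ξ : Omega1} :
    ξ ∈ p.dom ↔ ∃ n, p.map ξ = some n :=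
  Option.ne_none_iff_exists'

theorem mem_dom {p : UniformizingPoset C f} {ξ : Omega1} {n : ℕ} (h : p.map ξ = some n) :
    ξ ∈ p.dom :=
  mem_dom_iff.mpr ⟨n, h⟩

theorem dom_finite (p : UniformizingPoset C f) : p.dom.Finite := p.finite_dom

theorem ladder_inter_subset (p : UniformizingPoset C f) {α β : LimOmega1} {ξ : Omega1}
    (hα : α.1 ∈ p.dom) (hβ : β.1 ∈ p.dom) (hne : α ≠ β) (h : ξ ∈ C.ladder α) (h' : ξ ∈ C.ladder β) :
    ξ ∈ p.dom :=
  p.closed_dom α β hα hβ hne ⟨h, h'⟩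

/-- A criterion for compatibility; moreover, the common extension may have any given ordinals in its
domain. -/
theorem exists_le_le (p q : UniformizingPoset C f) {E : Set Omega1} (hE : E.Finite)
    (agree : ∀ ξ m n, p.map ξ = some m → q.map ξ = some n → m = n)
    (hpq : ∀ α : LimOmega1, α.1 ∈ p.dom → ∀ ξ : C.ladder α, ξ.1 ∈ q.dom → ξ.1 ∉ p.dom →
      q.map ξ.1 = some (f α ξ))
    (hqp : ∀ α : LimOmega1, α.1 ∈ q.dom → ∀ ξ : C.ladder α, ξ.1 ∈ p.dom → ξ.1 ∉ q.dom →
      p.map ξ.1 = some (f α ξ))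
    (hf : ∀ α β : LimOmega1, α.1 ∈ p.dom → β.1 ∈ q.dom → ∀ ξ (hα : ξ ∈ C.ladder α)
      (hβ : ξ ∈ C.ladder β), ξ ∉ p.dom → ξ ∉ q.dom → f α ⟨ξ, hα⟩ = f β ⟨ξ, hβ⟩) :
    ∃ r, r ≤ p ∧ r ≤ q ∧ E ⊆ r.dom := by
  -- One value meets all demands at `ξ`. Two ladders from the same condition cannot conflict off its
  -- domain, since that domain is `C`-closed; conflicts between `p` and `q` are excluded by
  -- hypothesis.
  have key : ∀ ξ : Omega1, ∃ n : ℕ, (∀ m, p.map ξ = some m → m = n) ∧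
      (∀ m, q.map ξ = some m → m = n) ∧
      (∀ α : LimOmega1, α.1 ∈ p.dom → ∀ h : ξ ∈ C.ladder α, ξ ∉ p.dom → f α ⟨ξ, h⟩ = n) ∧
      (∀ α : LimOmega1, α.1 ∈ q.dom → ∀ h : ξ ∈ C.ladder α, ξ ∉ q.dom → f α ⟨ξ, h⟩ = n) := by
    intro ξ
    by_cases hp : ξ ∈ p.dom
    · obtain ⟨n, hn⟩ := mem_dom_iff.mp hp
      refine ⟨n, fun m hm => by simpa [hn] using hm.symm, fun m hm => (agree _ _ _ hn hm).symm,
        fun α _ _ h => absurd hp h, fun α hα h hq => ?_⟩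
      have := hqp α hα ⟨ξ, h⟩ hp hq
      simpa [hn] using this.symm
    have hp' : ∀ m, p.map ξ ≠ some m := fun m hm => hp (mem_dom hm)
    by_cases hq : ξ ∈ q.dom
    · obtain ⟨n, hn⟩ := mem_dom_iff.mp hq
      refine ⟨n, fun m hm => absurd hm (hp' m), fun m hm => by simpa [hn] using hm.symm,
        fun α hα h _ => ?_, fun α _ _ h => absurd hq h⟩
      have := hpq α hα ⟨ξ, h⟩ hq hp
      simpa [hn] using this.symm
    have hq' : ∀ m, q.map ξ ≠ some m := fun m hm => hq (mem_dom hm)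
    by_cases h1 : ∃ α : LimOmega1, α.1 ∈ p.dom ∧ ξ ∈ C.ladder α
    · obtain ⟨α, hα, hξ⟩ := h1
      refine ⟨f α ⟨ξ, hξ⟩, fun m hm => absurd hm (hp' m), fun m hm => absurd hm (hq' m),
        fun β hβ h _ => ?_, fun β hβ h _ => (hf α β hα hβ ξ hξ h hp hq).symm⟩
      by_cases hαβ : α = β
      · subst hαβ; rfl
      · exact absurd (p.ladder_inter_subset hα hβ hαβ hξ h) hp
    by_cases h2 : ∃ α : LimOmega1, α.1 ∈ q.dom ∧ ξ ∈ C.ladder α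
    · obtain ⟨α, hα, hξ⟩ := h2
      refine ⟨f α ⟨ξ, hξ⟩, fun m hm => absurd hm (hp' m), fun m hm => absurd hm (hq' m),
        fun β hβ h _ => absurd ⟨β, hβ, h⟩ h1, fun β hβ h _ => ?_⟩
      by_cases hαβ : α = β
      · subst hαβ; rfl
      · exact absurd (q.ladder_inter_subset hα hβ hαβ hξ h) hq
    · exact ⟨0, fun m hm => absurd hm (hp' m), fun m hm => absurd hm (hq' m),
        fun β hβ h _ => absurd ⟨β, hβ, h⟩ h1, fun β hβ h _ => absurd ⟨β, hβ, h⟩ h2⟩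
  choose v hvp hvq hfp hfq using key
  obtain ⟨K, hsub, hfin, hcl⟩ :=
    C.exists_finite_isClosedSet ((p.dom_finite.union q.dom_finite).union hE)
  classical
  have hK : {ξ | (if ξ ∈ K then some (v ξ) else none) ≠ none} = K := by
    ext ξ
    simp
  let r : UniformizingPoset C f :=
    { map := fun ξ => if ξ ∈ K then some (v ξ) else none
      finite_dom := by rwa [hK]
      closed_dom := by rwa [hK] }
  have hr : ∀ ξ ∈ K, r.map ξ = some (v ξ) := fun ξ hξ => if_pos hξ
  have hrK : r.dom = K := hK
  refine ⟨r, ⟨fun ξ n h => ?_, fun α hα ξ h h' => ?_⟩, ⟨fun ξ n h => ?_, fun α hα ξ h h' => ?_⟩,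
    fun ξ hξ => ?_⟩
  · rw [hr ξ (hsub (Or.inl (Or.inl (mem_dom h)))), hvp ξ n h]
  · rw [hr ξ.1 (hrK ▸ h), ← hfp ξ.1 α hα ξ.2 h']
  · rw [hr ξ (hsub (Or.inl (Or.inr (mem_dom h)))), hvq ξ n h]
  · rw [hr ξ.1 (hrK ▸ h), ← hfq ξ.1 α hα ξ.2 h']
  · rw [hrK]
    exact hsub (Or.inr hξ)

theorem exists_le_mem_dom (p : UniformizingPoset C f) (ξ : Omega1) : ∃ q ≤ p, ξ ∈ q.dom := by
  obtain ⟨r, hr, -, h⟩ := exists_le_le p p (Set.finite_singleton ξ)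
    (fun ξ m n h h' => Option.some_injective _ (h.symm.trans h'))
    (fun α _ ξ h h' => absurd h h') (fun α _ ξ h h' => absurd h h')
    (fun α β hα hβ ξ h h' hξ _ => by
      by_cases hαβ : α = β
      · subst hαβ; rfl
      · exact absurd (p.ladder_inter_subset hα hβ hαβ h h') hξ)
  exact ⟨r, hr, h rfl⟩

/-- The graph of a condition, as a set of pairs. -/
def graph (p : UniformizingPoset C f) : Set (Omega1 × ℕ) := {x | p.map x.1 = some x.2}

/-- The part of a pair of graphs of the condition and of the colouring that is visible at
or below `η`. -/
def trace (η : Omega1) (p : UniformizingPoset C f) :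
    Set (Omega1 × ℕ) × Set (Set (Omega1 × ℕ)) :=
  (p.graph ∩ {x | x.1 ≤ η},
    {s | ∃ α : LimOmega1, α.1 ∈ p.dom ∧ η < α.1 ∧ s = f.graph α ∩ {x | x.1 ≤ η}})

/-- A ladder of a limit above `η` has finitely many points up to `η`, so a trace consists of a
finite set of pairs and a finite set of finite sets of pairs, over a countable base. -/
theorem countable_range_trace (η : Omega1) :
    (Set.range (trace (C := C) (f := f) η)).Countable := by
  have h0 : {x : Omega1 × ℕ | x.1 ≤ η}.Countable := by
    refine ((Omega1.countable_Iic η).prod Set.countable_univ).mono ?_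
    rintro ⟨ξ, n⟩ h
    exact ⟨h, trivial⟩
  have h1 := Set.countable_ofPred_finite_subset h0
  have h2 := Set.countable_ofPred_finite_subset h1
  refine (h1.prod h2).mono ?_
  rintro _ ⟨p, rfl⟩
  refine ⟨⟨?_, Set.inter_subset_right⟩, ?_, ?_⟩
  · refine (p.dom_finite.image fun ξ => (ξ, (p.map ξ).getD 0)).subset ?_
    rintro ⟨ξ, n⟩ ⟨h, -⟩
    have h : p.map ξ = some n := h
    exact ⟨ξ, mem_dom h, by simp [h]⟩
  · refine ((p.dom_finite.preimage (Subtype.val_injective.injOn)).image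
      fun α : LimOmega1 => f.graph α ∩ {x | x.1 ≤ η}).subset ?_
    rintro s ⟨α, hα, -, rfl⟩
    exact ⟨α, hα, rfl⟩
  · rintro s ⟨α, hα, hη, rfl⟩
    refine ⟨?_, Set.inter_subset_right⟩
    classical
    refine ((C.finite_ladder_inter_Iic hη).image fun ξ =>
      (ξ, if h : ξ ∈ C.ladder α then f α ⟨ξ, h⟩ else 0)).subset ?_
    rintro ⟨ξ, n⟩ ⟨⟨h, hn⟩, hle⟩
    exact ⟨ξ, ⟨h, hle⟩, by simpa [h] using hn⟩

theorem map_eq_of_trace_eq {η : Omega1} {p q : UniformizingPoset C f} (h : trace η p = trace η q)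
    {ξ : Omega1} (hξ : ξ ≤ η) : p.map ξ = q.map ξ := by
  have h1 := (Prod.ext_iff.mp h).1
  refine Option.ext fun n => ?_
  have := Set.ext_iff.mp h1 (ξ, n)
  simpa [trace, graph, hξ] using this

theorem mem_dom_iff_of_trace_eq {η : Omega1} {p q : UniformizingPoset C f}
    (h : trace η p = trace η q) {ξ : Omega1} (hξ : ξ ≤ η) : ξ ∈ p.dom ↔ ξ ∈ q.dom := by
  rw [mem_dom_iff, mem_dom_iff, map_eq_of_trace_eq h hξ]

theorem exists_ladder_of_trace_eq {η : Omega1} {p q : UniformizingPoset C f}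
    (h : trace η p = trace η q) {α : LimOmega1} (hα : α.1 ∈ p.dom) (hη : η < α.1) :
    ∃ β : LimOmega1, β.1 ∈ q.dom ∧ ∀ ξ ≤ η, ∀ hξ : ξ ∈ C.ladder α,
      ∃ hξ' : ξ ∈ C.ladder β, f β ⟨ξ, hξ'⟩ = f α ⟨ξ, hξ⟩ := by
  have h2 := (Prod.ext_iff.mp h).2
  have : f.graph α ∩ {x | x.1 ≤ η} ∈ (trace η q).2 := by
    rw [← h2]
    exact ⟨α, hα, hη, rfl⟩
  obtain ⟨β, hβ, -, heq⟩ := this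
  refine ⟨β, hβ, fun ξ hle hξ => ?_⟩
  have : (ξ, f α ⟨ξ, hξ⟩) ∈ f.graph β ∩ {x | x.1 ≤ η} := by
    rw [← heq]
    exact ⟨⟨hξ, rfl⟩, hle⟩
  exact this.1

/-- Two conditions with the same trace at `η` are compatible if one lives below `δ`, while the other
one has no elements and no ladder points in `(η, δ]`. -/
theorem exists_le_le_of_trace_eq {η δ : Omega1} {p q : UniformizingPoset C f}
    (h : trace η p = trace η q) (hp : ∀ ξ ∈ p.dom, ξ < δ)
    (hq : ∀ ξ ∈ q.dom, ξ ≤ η ∨ δ < ξ)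
    (hlad : ∀ α : LimOmega1, α.1 ∈ q.dom → δ < α.1 → ∀ ξ ∈ C.ladder α, ξ < δ → ξ ≤ η) :
    ∃ r, r ≤ p ∧ r ≤ q := by
  refine (exists_le_le p q Set.finite_empty ?_ ?_ ?_ ?_).imp fun r hr => ⟨hr.1, hr.2.1⟩
  · intro ξ m n hm hn
    have hle := (hq ξ (mem_dom hn)).resolve_right (hp ξ (mem_dom hm)).not_gt
    rw [map_eq_of_trace_eq h hle, hn] at hm
    exact (Option.some_injective _ hm).symm
  · intro α hα ξ hξ hξ'
    have hlt := (C.subset α ξ.2).trans (hp _ hα)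
    have hle := (hq ξ.1 hξ).resolve_right hlt.not_gt
    exact absurd ((mem_dom_iff_of_trace_eq h hle).mpr hξ) hξ'
  · intro α hα ξ hξ hξ'
    have hle : ξ.1 ≤ η := by
      rcases hq α.1 hα with hle | hlt
      · exact (C.subset α ξ.2).le.trans hle
      · exact hlad α hα hlt ξ.1 ξ.2 (hp _ hξ)
    exact absurd ((mem_dom_iff_of_trace_eq h hle).mp hξ) hξ'
  · intro α β hα hβ ξ hξα hξβ hξp hξq
    by_cases hαβ : α = β
    · subst hαβ; rfl
    rcases hq β.1 hβ with hle | hlt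
    · have := (mem_dom_iff_of_trace_eq h hle).mpr hβ
      exact absurd (p.ladder_inter_subset hα this hαβ hξα hξβ) hξp
    have hξ : ξ ≤ η := hlad β hβ hlt ξ hξβ ((C.subset α hξα).trans (hp _ hα))
    rcases le_or_gt α.1 η with hle | hgt
    · have := (mem_dom_iff_of_trace_eq h hle).mp hα
      exact absurd (q.ladder_inter_subset this hβ hαβ hξα hξβ) hξq
    -- Here `α` and `β` both lie above `η`. The trace provides a twin `α'` of `α` in the domain of
    -- `q`, with the same colours up to `η`; either it is `β`, or `q` being `C`-closed puts `ξ` in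
    -- its domain.
    obtain ⟨α', hα', hf⟩ := exists_ladder_of_trace_eq h hα hgt
    obtain ⟨hξ', heq⟩ := hf ξ hξ hξα
    by_cases h' : α' = β
    · subst h'
      exact heq.symm
    · exact absurd (q.ladder_inter_subset hα' hβ h' hξ' hξβ) hξq

/-- A strong form of the countable chain condition. -/
theorem exists_rel_and_compatible {I : Type*} [Uncountable I] (p : I → UniformizingPoset C f)
    (rel : I → I → Prop)
    (hrel : ∀ X : Set I, ¬ X.Countable → ∃ X₀ ⊆ X, X₀.Countable ∧ ∃ N : Set I, N.Countable ∧
      ∀ j ∈ X \ N, ∃ i ∈ X₀, rel i j) :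
    ∃ i j, rel i j ∧ ∃ r, r ≤ p i ∧ r ≤ p j := by
  have hrel' : ∀ X : Set I, ∃ X₀ ⊆ X, X₀.Countable ∧ ∃ N : Set I, N.Countable ∧
      ∀ j ∈ X \ N, ∃ i ∈ X₀, rel i j := by
    intro X
    by_cases hX : X.Countable
    · exact ⟨∅, Set.empty_subset _, Set.countable_empty, X, hX, fun j hj => absurd hj.1 hj.2⟩
    · exact hrel X hX
  choose X₀ hX₀ hcount N hN hX₀N using hrel'
  let X : Omega1 → Set (Omega1 × ℕ) × Set (Set (Omega1 × ℕ)) → Set I :=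
    fun η τ => {i | trace η (p i) = τ}
  -- The function `g` bounds the domains of all chosen representatives, over all traces at `η`; at a
  -- closure point `δ` of `g` they stay below `δ` for each `η < δ`.
  have hg : ∀ η, ∃ β, ∀ τ ∈ Set.range (trace (C := C) (f := f) η), ∀ i ∈ X₀ (X η τ),
      ∀ ξ ∈ (p i).dom, ξ < β := by
    intro η
    obtain ⟨β, hβ⟩ := Omega1.exists_forall_lt_of_countable
      ((countable_range_trace (C := C) (f := f) η).biUnion fun τ _ =>
        (hcount (X η τ)).biUnion fun i _ => (p i).dom_finite.countable)
    exact ⟨β, fun τ hτ i hi ξ hξ =>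
      hβ ξ (Set.mem_biUnion hτ (Set.mem_biUnion hi hξ))⟩
  choose g hg using hg
  choose c hc hcg using Omega1.exists_closure_point g
  obtain ⟨β₀⟩ : Nonempty Omega1 := inferInstance
  let d : ℕ → Omega1 := fun n => c (c^[n] β₀)
  have hd : StrictMono d := strictMono_nat_of_lt_succ fun n => by
    simp only [d, Function.iterate_succ_apply']
    exact hc _
  obtain ⟨B, hB⟩ := Omega1.exists_forall_lt_of_countable (Set.countable_range d)
  -- The index `j` must be fixed before `δ` and `η`, which depend on it, so it avoids the
  -- exceptional sets of all `η < B` at once.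
  have hNc : (⋃ η ∈ Set.Iio B, ⋃ τ ∈ Set.range (trace (C := C) (f := f) η),
      N (X η τ)).Countable :=
    (Omega1.countable_Iio B).biUnion fun η _ => (countable_range_trace η).biUnion fun τ _ => hN _
  obtain ⟨j, hj⟩ : ∃ j, j ∉ (⋃ η ∈ Set.Iio B, ⋃ τ ∈ Set.range (trace (C := C) (f := f) η),
      N (X η τ)) := by
    by_contra! h
    exact Set.not_countable_univ (hNc.mono fun i _ => h i)
  -- If `δ` were a limit in the domain, its own ladder would be unbounded below `δ`. Infinitely many
  -- closure points are at hand to avoid this.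
  obtain ⟨n, hn⟩ : ∃ n, d n ∉ (p j).dom := by
    by_contra! h
    exact Set.infinite_range_of_injective hd.injective
      ((p j).dom_finite.subset (Set.range_subset_iff.mpr h))
  set δ := d n with hδ
  let S : Set Omega1 := ((p j).dom ∩ Set.Iio δ) ∪
    ⋃ α ∈ {α : LimOmega1 | α.1 ∈ (p j).dom}, {ξ | δ < α.1 ∧ ξ ∈ C.ladder α ∧ ξ < δ}
  have hS : S.Finite := by
    refine ((p j).dom_finite.inter_of_left _).union
      (((p j).dom_finite.preimage (Subtype.val_injective.injOn)).biUnion fun α _ => ?_)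
    by_cases h : δ < α.1
    · exact (C.finite_ladder_inter_Iic h).subset fun ξ hξ => ⟨hξ.2.1, hξ.2.2.le⟩
    · exact Set.finite_empty.subset fun ξ hξ => h hξ.1
  obtain ⟨η, hηδ, hη⟩ := Omega1.exists_bound_of_finite_of_lt hS (hc _ : _ < δ) (by
    rintro ξ (hξ | hξ)
    · exact hξ.2
    · obtain ⟨α, -, h⟩ := Set.mem_iUnion₂.mp hξ
      exact h.2.2)
  have hjN : j ∉ N (X η (trace η (p j))) := fun h => hj <|
    Set.mem_biUnion (hηδ.trans (hB _ ⟨n, rfl⟩)) (Set.mem_biUnion ⟨p j, rfl⟩ h)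
  obtain ⟨i, hi, hij⟩ := hX₀N (X η (trace η (p j))) j ⟨rfl, hjN⟩
  refine ⟨i, j, hij, exists_le_le_of_trace_eq (η := η) (δ := δ) (hX₀ _ hi)
    (fun ξ hξ => (hg η _ ⟨p j, rfl⟩ i hi ξ hξ).trans (hcg _ η hηδ)) (fun ξ hξ => ?_)
    fun α hα hlt ξ hξ hξδ => hη ξ (Or.inr (Set.mem_biUnion hα ⟨hlt, hξ, hξδ⟩))⟩
  rcases lt_trichotomy ξ δ with h | h | h
  · exact Or.inl (hη ξ (Or.inl ⟨hξ, h⟩))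
  · exact absurd (h ▸ hξ) hn
  · exact Or.inr h

theorem exists_ne_and_compatible {I : Type*} [Uncountable I] (p : I → UniformizingPoset C f) :
    ∃ i j, i ≠ j ∧ ∃ r, r ≤ p i ∧ r ≤ p j := by
  refine exists_rel_and_compatible p (· ≠ ·) fun X hX => ?_
  have : X.Nonempty := Set.nonempty_iff_ne_empty.mpr fun h => hX (h ▸ Set.countable_empty)
  obtain ⟨i, hi⟩ := this
  exact ⟨{i}, by simpa using hi, Set.countable_singleton i, {i}, Set.countable_singleton i,
    fun j hj => ⟨i, rfl, fun h => hj.2 h.symm⟩⟩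

theorem isCCC : IsCCC (UniformizingPoset C f) := by
  intro A hA
  by_contra h
  have : Uncountable A := ⟨h⟩
  obtain ⟨i, j, hij, hr⟩ := exists_ne_and_compatible fun i : A => i.1
  exact hA i i.2 j j.2 (fun h => hij (Subtype.ext h)) hr

theorem mk_eq : Cardinal.mk (UniformizingPoset C f) = Cardinal.aleph 1 := by
  have hO : #Omega1 = aleph 1 := by simp
  have hinf : ℵ₀ ≤ #Omega1 := by rw [hO]; exact Cardinal.aleph0_le_aleph 1
  apply le_antisymm
  · have hfin : ∀ p : UniformizingPoset C f, p.graph.Finite := fun p => by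
      refine (p.dom_finite.image fun ξ => (ξ, (p.map ξ).getD 0)).subset ?_
      rintro ⟨ξ, n⟩ h
      have h : p.map ξ = some n := h
      exact ⟨ξ, mem_dom h, by simp [h]⟩
    have hinj : Function.Injective fun p : UniformizingPoset C f => (hfin p).toFinset := by
      intro p q h
      have h : p.graph = q.graph := by simpa using h
      refine UniformizingPoset.ext (funext fun ξ => Option.ext fun n => ?_)
      exact Set.ext_iff.mp h (ξ, n)
    have : Infinite Omega1 := Cardinal.infinite_iff.mpr hinf
    refine (Cardinal.mk_le_of_injective hinj).trans ?_
    rw [Cardinal.mk_finset_of_infinite, Cardinal.mk_prod, Cardinal.lift_id, Cardinal.lift_id,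
      Cardinal.mk_nat, Cardinal.mul_aleph0_eq hinf, hO]
  · rw [← hO]
    classical
    have hdom : ∀ ξ₀ : Omega1, {ξ | (if ξ = ξ₀ then some 0 else none : Option ℕ) ≠ none} = {ξ₀} := by
      intro ξ₀
      ext ξ
      simp
    refine Cardinal.mk_le_of_injective (f := fun ξ₀ => (
      { map := fun ξ => if ξ = ξ₀ then some 0 else none
        finite_dom := by rw [hdom]; exact Set.finite_singleton _
        closed_dom := by
          rw [hdom]
          exact fun α β hα hβ h => absurd (Subtype.ext (hα.trans hβ.symm)) h } :
      UniformizingPoset C f)) fun ξ₀ ξ₁ h => ?_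
    have := congrFun (congrArg UniformizingPoset.map h) ξ₀
    by_contra hne
    simp [hne] at this

end UniformizingPoset


/-! ### Forcing calculus, countability of names and absoluteness of heights -/

namespace Forcing

variable {P : Type*} [PartialOrder P] {X I : Type*}

theorem mem_mono {x : X} {A : Name P X} {p q : P} (h : mem x A p) (hq : q ≤ p) : mem x A q :=
  fun r hr => h r (hr.trans hq)

theorem imp_intro {φ ψ : Sentence P} {p : P} (h : ∀ q ≤ p, φ q → ψ q) : imp φ ψ p :=
  fun q hq hφ => hφ.2 q le_rfl (h q hq hφ.1)

/-- A `Sentence` is an arbitrary predicate, and `imp` is defined through `neg`, so the conclusion is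
reached only at some stronger condition. -/
theorem exists_of_imp {φ ψ : Sentence P} {p q : P} (h : imp φ ψ p) (hq : q ≤ p) (hφ : φ q) :
    ∃ r ≤ q, ψ r := by
  by_contra! hψ
  exact h q hq ⟨hφ, hψ⟩

theorem of_imp_truth {φ : Sentence P} {a : Prop} {p q : P} (h : imp φ (truth a) p) (hq : q ≤ p)
    (hφ : φ q) : a :=
  (exists_of_imp h hq hφ).choose_spec.2

theorem ex_intro {φ : I → Sentence P} {p : P} (h : ∀ q ≤ p, ∃ i, ∃ r ≤ q, φ i r) : ex φ p := by
  intro q hq hall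
  obtain ⟨i, r, hr, hφ⟩ := h q hq
  exact hall i r hr hφ

theorem exists_of_ex {φ : I → Sentence P} {p q : P} (h : ex φ p) (hq : q ≤ p) :
    ∃ i, ∃ r ≤ q, φ i r := by
  by_contra! hall
  exact h q hq hall

/-- The canonical name for a subset of `X` in the ground model. -/
def checkSet (P : Type*) (S : Set X) : Name P X := {x | x.1 ∈ S}

theorem mem_checkSet {S : Set X} {x : X} {p : P} : mem x (checkSet P S) p ↔ x ∈ S :=
  ⟨fun h => (h p le_rfl).choose_spec.2.choose_spec.1, fun h q _ => ⟨q, le_rfl, q, h, le_rfl⟩⟩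

theorem mem_check {x : X} {p : P} : mem x (check P X) p :=
  fun q _ => ⟨q, le_rfl, q, trivial, le_rfl⟩

/-- A name for a set is forced to be countable if there are only countably many candidates for
its elements. -/
theorem countable_of_countable_setOf {A : Name P X} {p : P}
    (h : {x | ∃ q ≤ p, mem x A q}.Countable) : countable A p := by
  obtain ⟨e, he⟩ := Set.countable_iff_exists_injOn.mp h
  -- A name for the restriction to `A` of the ground-model map `e`, which is injective on the
  -- possible elements.
  let F : Name P (X × ℕ) := {y | y.1.2 = e y.1.1 ∧ (y.1.1, y.2) ∈ A}
  have hF : ∀ x n (q : P), mem (x, n) F q ↔ n = e x ∧ mem x A q := by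
    intro x n q
    constructor
    · intro h
      refine ⟨(h q le_rfl).choose_spec.2.choose_spec.1.1, fun r hr => ?_⟩
      obtain ⟨s, hs, a, ha, hsa⟩ := h r hr
      exact ⟨s, hs, a, ha.2, hsa⟩
    · rintro ⟨hn, h⟩ r hr
      obtain ⟨s, hs, a, ha, hsa⟩ := h r hr
      exact ⟨s, hs, a, ⟨hn, ha⟩, hsa⟩
  refine ex_intro fun q hq => ⟨F, q, le_rfl, ?_, ?_, ?_, ?_⟩
  · exact fun x n => imp_intro fun r _ hr => ((hF x n r).mp hr).2
  · exact fun x => imp_intro fun r _ hr => ex_intro fun s hs =>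
      ⟨e x, s, le_rfl, (hF _ _ _).mpr ⟨rfl, mem_mono hr hs⟩⟩
  · exact fun x m n => imp_intro fun r _ hr =>
      ((hF _ _ _).mp hr.1).1.trans ((hF _ _ _).mp hr.2).1.symm
  · refine fun x y n => imp_intro fun r hr h => ?_
    obtain ⟨h1, hx⟩ := (hF _ _ _).mp h.1
    obtain ⟨h2, hy⟩ := (hF _ _ _).mp h.2
    exact he ⟨r, hr.trans hq, hx⟩ ⟨r, hr.trans hq, hy⟩ (h1.symm.trans h2)

/-- A name for a set `A` is forced to be countable if, for any uncountable family of
conditions deciding elements of `A`, there are two compatible ones deciding elements which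
cannot both belong to `A`. -/
theorem countable_of_uncountable_family {A : Name P X} {p : P}
    (h : ∀ S : Set X, ¬ S.Countable → ∀ c : S → P, (∀ x, c x ≤ p) → (∀ x, mem x.1 A (c x)) → False) :
    countable A p := by
  refine countable_of_countable_setOf ?_
  by_contra hS
  choose c hc hmem using fun x : {x | ∃ q ≤ p, mem x A q} => x.2
  exact h _ hS c hc hmem

section

variable {R : Type*} [PartialOrder R]

theorem hasHeight_of_hasHeight {t : R} {α : Omega1} (h : HasHeight t α) (p : P) :
    hasHeight t α p := by
  obtain ⟨g⟩ := h
  refine ex_intro fun q hq =>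
    ⟨checkSet P {x | ∃ h : x.1 < t, (g ⟨x.1, h⟩).1 = x.2}, q, le_rfl, ?_, ?_, ?_, ?_⟩
  · refine fun s β => imp_intro fun r _ h => ?_
    obtain ⟨hs, h⟩ := mem_checkSet.mp h
    dsimp only at hs h
    exact ⟨hs, h ▸ (g ⟨s, hs⟩).2⟩
  · exact fun s => imp_intro fun r _ hs => ex_intro fun u _ =>
      ⟨(g ⟨s, hs⟩).1, u, le_rfl, mem_checkSet.mpr ⟨hs, rfl⟩⟩
  · exact fun β => imp_intro fun r _ hβ => ex_intro fun u _ =>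
      ⟨(g.symm ⟨β, hβ⟩).1, u, le_rfl, mem_checkSet.mpr ⟨(g.symm ⟨β, hβ⟩).2, by simp⟩⟩
  · refine fun s s' β β' => imp_intro fun r _ h => ?_
    obtain ⟨hs, h1⟩ := mem_checkSet.mp h.1
    obtain ⟨hs', h2⟩ := mem_checkSet.mp h.2
    dsimp only at hs h1 hs' h2
    have := g.map_rel_iff (a := ⟨s, hs⟩) (b := ⟨s', hs'⟩)
    change s ≤ s' ↔ β ≤ β'
    rw [← h1, ← h2]
    exact this.symm

/-- Heights of nodes are absolute. -/
theorem eq_of_hasHeight {t : R} {α β : Omega1} (hβ : HasHeight t β) {p : P}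
    (h : hasHeight t α p) : α = β := by
  obtain ⟨g⟩ := hβ
  obtain ⟨F, q, -, hsub, hdom, hran, hord⟩ := exists_of_ex h le_rfl
  have hdom' : ∀ s, s < t → ∀ r ≤ q, ∃ γ, ∃ u ≤ r, mem (s, γ) F u := by
    intro s hs r hr
    obtain ⟨u, hu, h⟩ := exists_of_imp (hdom s) hr hs
    obtain ⟨γ, v, hv, h⟩ := exists_of_ex h le_rfl
    exact ⟨γ, v, hv.trans hu, h⟩
  have hran' : ∀ γ, γ < α → ∀ r ≤ q, ∃ s, ∃ u ≤ r, mem (s, γ) F u := by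
    intro γ hγ r hr
    obtain ⟨u, hu, h⟩ := exists_of_imp (hran γ) hr hγ
    obtain ⟨s, v, hv, h⟩ := exists_of_ex h le_rfl
    exact ⟨s, v, hv.trans hu, h⟩
  -- Uniqueness of isomorphisms of well-orders, by induction on the true position `δ` of `s`. A
  -- smaller value `γ` is already taken by the node at position `γ`; a larger one leaves `δ` to a
  -- node below `s`, contrary to induction.
  have key : ∀ δ : Omega1, ∀ s (hs : s < t), (g ⟨s, hs⟩).1 = δ → ∀ r ≤ q, ∀ γ,
      mem (s, γ) F r → γ = δ := by
    intro δ
    induction δ using WellFoundedLT.induction with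
    | ind δ ih =>
      intro s hs hgs r hr γ hγ
      rcases lt_trichotomy γ δ with hlt | heq | hgt
      · have hγβ : γ < β := hlt.trans (hgs ▸ (g ⟨s, hs⟩).2)
        obtain ⟨⟨s', hs'⟩, hgs'⟩ := g.surjective ⟨γ, hγβ⟩
        have hgs' : (g ⟨s', hs'⟩).1 = γ := congrArg Subtype.val hgs'
        obtain ⟨γ', u, hu, hγ'⟩ := hdom' s' hs' r hr
        have := ih γ hlt s' hs' hgs' u (hu.trans hr) γ' hγ'
        subst this
        have hiff := of_imp_truth (hord s s' γ' γ') (hu.trans hr) ⟨mem_mono hγ hu, hγ'⟩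
        have hle : g ⟨s, hs⟩ ≤ g ⟨s', hs'⟩ := g.monotone (hiff.mpr le_rfl)
        have hle : (g ⟨s, hs⟩).1 ≤ (g ⟨s', hs'⟩).1 := hle
        rw [hgs, hgs'] at hle
        exact absurd hle hlt.not_ge
      · exact heq
      · have hγα := (of_imp_truth (hsub s γ) hr hγ).2
        obtain ⟨s', u, hu, hs'⟩ := hran' δ (hgt.trans hγα) r hr
        have hs't := (of_imp_truth (hsub s' δ) (hu.trans hr) hs').1
        have hiff := of_imp_truth (hord s s' γ δ) (hu.trans hr) ⟨mem_mono hγ hu, hs'⟩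
        have hiff' := of_imp_truth (hord s' s δ γ) (hu.trans hr) ⟨hs', mem_mono hγ hu⟩
        have hlt : s' < s := lt_of_le_not_ge (hiff'.mpr hgt.le) fun h => (hiff.mp h).not_gt hgt
        have hglt : g ⟨s', hs't⟩ < g ⟨s, hs⟩ := g.strictMono hlt
        have hglt : (g ⟨s', hs't⟩).1 < δ := hgs ▸ hglt
        exact absurd (ih _ hglt s' hs't rfl u (hu.trans hr) δ hs') hglt.ne'
  have hiff : ∀ γ, γ < α ↔ γ < β := by
    intro γ
    constructor
    · intro hγ
      obtain ⟨s, u, hu, h⟩ := hran' γ hγ q le_rfl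
      have hs := (of_imp_truth (hsub s γ) hu h).1
      rw [key _ s hs rfl u hu γ h]
      exact (g ⟨s, hs⟩).2
    · intro hγ
      obtain ⟨⟨s, hs⟩, hgs⟩ := g.surjective ⟨γ, hγ⟩
      have hgs : (g ⟨s, hs⟩).1 = γ := congrArg Subtype.val hgs
      obtain ⟨γ', u, hu, h⟩ := hdom' s hs q le_rfl
      rw [← key γ s hs hgs u hu γ' h]
      exact (of_imp_truth (hsub s γ') hu h).2
  exact eq_of_forall_lt_iff hiff

end

end Forcing

/-! ### Combinatorics of Suslin trees -/

namespace IsSuslinTree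

variable {R : Type*} [PartialOrder R]

theorem le_total_of_le (hR : IsSuslinTree R) {s u t : R} (hs : s ≤ t) (hu : u ≤ t) :
    s ≤ u ∨ u ≤ s := by
  rcases hs.eq_or_lt with rfl | hs
  · exact Or.inr hu
  rcases hu.eq_or_lt with rfl | hu
  · exact Or.inl hs.le
  have := hR.wellOrdered t
  rcases trichotomous_of (· < ·) (⟨s, hs⟩ : Set.Iio t) ⟨u, hu⟩ with h | h | h
  · exact Or.inl (le_of_lt h)
  · exact Or.inl (congrArg Subtype.val h).le
  · exact Or.inr (le_of_lt h)

theorem wellFounded (hR : IsSuslinTree R) : WellFounded ((· < ·) : R → R → Prop) := by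
  have hacc : ∀ t : R, ∀ s : Set.Iio t, Acc ((· < ·) : R → R → Prop) s.1 := by
    intro t s
    have := hR.wellOrdered t
    induction s using WellFounded.induction (IsWellFounded.wf (r := ((· < ·) :
      Set.Iio t → Set.Iio t → Prop))) with
    | _ s ih => exact ⟨_, fun u hu => ih ⟨u, hu.trans s.2⟩ hu⟩
  exact ⟨fun t => ⟨t, fun s hs => hacc t ⟨s, hs⟩⟩⟩

theorem countable_Iic (hR : IsSuslinTree R) (t : R) : (Set.Iic t).Countable :=
  hR.chain_countable _ fun _ hs _ hu _ => hR.le_total_of_le hs hu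

/-- All but countably many elements of a subset of a Suslin tree lie above some other element, which
can be chosen from a given countable subset. -/
theorem exists_countable_lt (hR : IsSuslinTree R) (X : Set R) :
    ∃ X₀ ⊆ X, X₀.Countable ∧ ∀ t ∈ X \ X₀, ∃ s ∈ X₀, s < t := by
  -- The minimal elements of `X` form an antichain, hence a countable set.
  refine ⟨{s | Minimal (· ∈ X) s}, fun s hs => hs.1,
    hR.antichain_countable _ (setOfPred_minimal_antichain _), fun t ht => ?_⟩
  have hne : (X ∩ Set.Iic t).Nonempty := ⟨t, ht.1, le_rfl⟩
  have hmem := hR.wellFounded.min_mem _ hne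
  set s := hR.wellFounded.min _ hne
  have hs : Minimal (· ∈ X) s := by
    refine ⟨hmem.1, fun u hu hus => ?_⟩
    by_contra h
    exact hR.wellFounded.not_lt_min (X ∩ Set.Iic t) ⟨hu, hus.trans hmem.2⟩ (lt_of_le_not_ge hus h)
  refine ⟨s, hs, lt_of_le_of_ne hmem.2 fun h => ht.2 ?_⟩
  rw [← h]
  exact hs

/-- Every uncountable subset of a Suslin tree contains two elements such that all but countably
many nodes are incomparable with one of them. -/
theorem exists_countable_incomparable (hR : IsSuslinTree R) {X : Set R} (hX : ¬ X.Countable) :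
    ∃ X₀ ⊆ X, X₀.Countable ∧ ∃ N : Set R, N.Countable ∧
      ∀ t ∉ N, ∃ s ∈ X₀, ¬ (s ≤ t ∨ t ≤ s) := by
  have : ¬ IsChain (· ≤ ·) X := fun h => hX (hR.chain_countable X h)
  obtain ⟨s, hs, u, hu, h⟩ : ∃ s ∈ X, ∃ u ∈ X, ¬ (s ≤ u ∨ u ≤ s) := by
    by_contra! h
    exact this fun s hs u hu _ => h s hs u hu
  refine ⟨{s, u}, by simp [Set.insert_subset_iff, hs, hu], (Set.toFinite _).countable,
    Set.Iic s ∪ Set.Iic u, (hR.countable_Iic s).union (hR.countable_Iic u), fun t ht => ?_⟩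
  -- A node outside `N` that is comparable with both `s` and `u` lies above both, making them
  -- comparable.
  by_contra! hall
  have h1 := (hall s (by simp)).resolve_right fun h => ht (Or.inl h)
  have h2 := (hall u (by simp)).resolve_right fun h => ht (Or.inr h)
  exact h (hR.le_total_of_le h1 h2)

end IsSuslinTree

/-! ### Preservation of `ω₁`, the uniformization, chains and antichains -/

namespace UniformizingPoset

open Forcing

variable {C : LadderSystem} {f : C.Colouring}

/-- Given a name for an injection into `ω`, uncountably many ordinals are sent by suitable
conditions to the same `k`; two of these conditions are compatible, contradicting injectivity. -/
theorem forced_omega1Preserved (p : UniformizingPoset C f) : omega1Preserved p := by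
  intro q _ hc
  obtain ⟨F, r, -, -, hdom, -, hinj⟩ := exists_of_ex hc le_rfl
  have : ∀ ξ : Omega1, ∃ n, ∃ u ≤ r, mem (ξ, n) F u := by
    intro ξ
    obtain ⟨u, hu, h⟩ := exists_of_imp (hdom ξ) le_rfl mem_check
    obtain ⟨n, v, hv, h⟩ := exists_of_ex h le_rfl
    exact ⟨n, v, hv.trans hu, h⟩
  choose n c hc hmem using this
  obtain ⟨k, hk⟩ : ∃ k, ¬ (n ⁻¹' {k}).Countable := by
    by_contra! h
    refine Set.not_countable_univ ((Set.countable_iUnion h).mono fun ξ _ => ?_)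
    exact Set.mem_iUnion.mpr ⟨n ξ, rfl⟩
  have : Uncountable (n ⁻¹' {k}) := ⟨hk⟩
  obtain ⟨ξ, ζ, hne, s, hs1, hs2⟩ := exists_ne_and_compatible fun ξ : n ⁻¹' {k} => c ξ
  refine hne (Subtype.ext (of_imp_truth (hinj ξ.1 ζ.1 k) (hs1.trans (hc _)) ⟨?_, ?_⟩))
  · have h := mem_mono (hmem ξ) hs1
    rwa [show n ξ = k from ξ.2] at h
  · have h := mem_mono (hmem ζ) hs2
    rwa [show n ζ = k from ζ.2] at h

/-- The name for the union of the generic filter. -/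
def genericMap (C : LadderSystem) (f : C.Colouring) :
    Name (UniformizingPoset C f) (Omega1 × ℕ) :=
  {x | x.2.map x.1.1 = some x.1.2}

theorem mem_genericMap_of_map_eq {p : UniformizingPoset C f} {ξ : Omega1} {n : ℕ}
    (h : p.map ξ = some n) : mem (ξ, n) (genericMap C f) p :=
  fun q hq => ⟨q, le_rfl, p, h, hq⟩

theorem exists_map_eq_of_mem_genericMap {p : UniformizingPoset C f} {ξ : Omega1} {n : ℕ}
    (h : mem (ξ, n) (genericMap C f) p) : ∃ q ≤ p, q.map ξ = some n := by
  obtain ⟨r, hr, a, ha, hra⟩ := h p le_rfl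
  exact ⟨r, hr, hra.1 ξ n ha⟩

theorem isUniformization_genericMap (p : UniformizingPoset C f) :
    isUniformization C f (genericMap C f) p := by
  refine ⟨fun ξ => ex_intro fun q _ => ?_, fun ξ m n => imp_intro fun q _ h => ?_,
    fun α => ex_intro fun q _ => ?_⟩
  · obtain ⟨r, hr, hξ⟩ := exists_le_mem_dom q ξ
    obtain ⟨n, hn⟩ := mem_dom_iff.mp hξ
    exact ⟨n, r, hr, mem_genericMap_of_map_eq hn⟩
  · obtain ⟨r, hr, hm⟩ := exists_map_eq_of_mem_genericMap h.1
    obtain ⟨s, hs, hn⟩ := exists_map_eq_of_mem_genericMap (mem_mono h.2 hr)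
    exact Option.some_injective _ ((hs.1 ξ m hm).symm.trans hn)
  · obtain ⟨r, hr, hα⟩ := exists_le_mem_dom q α.1
    -- The finite exceptional set is the domain of a condition containing `α`; off it, the ordering
    -- dictates the colour.
    refine ⟨r.dom_finite.toFinset, r, hr, fun ξ => imp_intro fun s hs hξ u hu => ?_⟩
    have hξ : ξ.1 ∉ r.dom := by simpa [truth] using hξ
    obtain ⟨v, hv, hξv⟩ := exists_le_mem_dom u ξ.1
    exact ⟨v, hv, v, (hv.trans (hu.trans hs)).2 α hα ξ hξv hξ, le_rfl⟩

theorem forced_hasUniformization (p : UniformizingPoset C f) : hasUniformization C f p :=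
  ⟨forced_omega1Preserved p, ex_intro fun q _ =>
    ⟨genericMap C f, q, le_rfl, isUniformization_genericMap q⟩⟩

variable {R : Type*} [PartialOrder R]

theorem forced_chainsCountable (hR : IsSuslinTree R) (p : UniformizingPoset C f) :
    chainsCountable (UniformizingPoset C f) R p := by
  refine fun A => imp_intro fun q _ hA => countable_of_uncountable_family fun S hS c hc hmem => ?_
  have : Uncountable S := ⟨hS⟩
  obtain ⟨s, t, hst, r, hrs, hrt⟩ := exists_rel_and_compatible c
    (fun s t => ¬ (s.1 ≤ t.1 ∨ t.1 ≤ s.1)) fun X hX => by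
      obtain ⟨X₀, hsub, hcount, N, hN, h⟩ := hR.exists_countable_incomparable
        (X := Subtype.val '' X)
        fun h => hX (Set.countable_of_injective_of_countable_image Subtype.val_injective.injOn h)
      refine ⟨Subtype.val ⁻¹' X₀, ?_, hcount.preimage Subtype.val_injective, Subtype.val ⁻¹' N,
        hN.preimage Subtype.val_injective, fun t ht => ?_⟩
      · intro s hs
        obtain ⟨s', hs', heq⟩ := hsub hs
        rwa [← Subtype.ext heq]
      · obtain ⟨s, hs, hst⟩ := h t.1 ht.2
        obtain ⟨s', -, rfl⟩ := hsub hs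
        exact ⟨s', hs, hst⟩
  exact hst (of_imp_truth (hA s.1 t.1) (hrs.trans (hc s))
    ⟨mem_mono (hmem s) hrs, mem_mono (hmem t) hrt⟩)

theorem forced_antichainsCountable (hR : IsSuslinTree R) (p : UniformizingPoset C f) :
    antichainsCountable (UniformizingPoset C f) R p := by
  refine fun A => imp_intro fun q _ hA => countable_of_uncountable_family fun S hS c hc hmem => ?_
  have : Uncountable S := ⟨hS⟩
  obtain ⟨s, t, hst, r, hrs, hrt⟩ := exists_rel_and_compatible c
    (fun s t => s.1 < t.1) fun X _ => by
      obtain ⟨X₀, hsub, hcount, h⟩ := hR.exists_countable_lt (Subtype.val '' X)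
      have hX₀ := hcount.preimage (Subtype.val_injective (p := (· ∈ S)))
      refine ⟨Subtype.val ⁻¹' X₀, ?_, hX₀, Subtype.val ⁻¹' X₀, hX₀, fun t ht => ?_⟩
      · intro s hs
        obtain ⟨s', hs', heq⟩ := hsub hs
        rwa [← Subtype.ext heq]
      · obtain ⟨s, hs, hst⟩ := h t.1 ⟨⟨t, ht.1, rfl⟩, ht.2⟩
        obtain ⟨s', -, rfl⟩ := hsub hs
        exact ⟨s', hs, hst⟩
  exact of_imp_truth (hA s.1 t.1) (hrs.trans (hc s))
    ⟨mem_mono (hmem s) hrs, mem_mono (hmem t) hrt⟩ hst.ne hst.le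

end UniformizingPoset

/-! ### Tree structure, levels and height -/

namespace Forcing

variable {P : Type*} [PartialOrder P] {R : Type*} [PartialOrder R]

theorem forced_isTree (hR : IsSuslinTree R) (p : P) : isTree P R p := by
  refine fun t A => imp_intro fun q _ ⟨hsub, hne⟩ => ex_intro fun r hr => ?_
  -- The ground-model set of possible elements: its least member is put into `A` by some `u ≤ r`,
  -- and below `u` nothing smaller can enter `A`.
  let S : Set R := {s | ∃ u ≤ r, mem s A u}
  have hS : S.Nonempty := by
    obtain ⟨s, u, hu, h⟩ := exists_of_ex hne hr
    exact ⟨s, u, hu, h⟩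
  have hSt : ∀ s ∈ S, s < t := fun s ⟨u, hu, h⟩ => of_imp_truth (hsub s) (hu.trans hr) h
  obtain ⟨u, hu, hmem⟩ := hR.wellFounded.min_mem S hS
  refine ⟨hR.wellFounded.min S hS, u, hu, hmem, fun s => imp_intro fun v hv h => ?_⟩
  have hs : s ∈ S := ⟨v, hv.trans hu, h⟩
  rcases hR.le_total_of_le (hSt _ ⟨u, hu, hmem⟩).le (hSt s hs).le with hle | hle
  · exact hle
  · exact (eq_or_lt_of_le hle).elim (fun h => h.ge)
      fun h => absurd h (hR.wellFounded.not_lt_min S hs)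

theorem forced_levelsCountable (hR : IsSuslinTree R) (p : P) : levelsCountable P R p := by
  refine fun α L => imp_intro fun q _ hL => countable_of_countable_setOf ?_
  refine (hR.level_countable α).mono ?_
  rintro t ⟨r, hr, h⟩
  obtain ⟨β, hβ⟩ := hR.height_lt t
  obtain ⟨u, -, hu⟩ := exists_of_imp (hL t) hr h
  obtain rfl := eq_of_hasHeight hβ hu
  exact hβ

theorem forced_heightOmega1 (hR : IsSuslinTree R) {p : P} (hp : omega1Preserved p) :
    heightOmega1 P R p := by
  refine ⟨hp, fun t => ex_intro fun q _ => ?_, fun α => ex_intro fun q _ => ?_⟩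
  · obtain ⟨α, hα⟩ := hR.height_lt t
    exact ⟨α, q, le_rfl, hasHeight_of_hasHeight hα q⟩
  · obtain ⟨t, ht⟩ := hR.level_nonempty α
    exact ⟨t, q, le_rfl, hasHeight_of_hasHeight ht q⟩

end Forcing

theorem theorem4p1 (C : LadderSystem) (f : C.Colouring) :
    IsCCC (UniformizingPoset C f) ∧
    Cardinal.mk (UniformizingPoset C f) = Cardinal.aleph 1 ∧
    Forcing.Forced (P := UniformizingPoset C f) (Forcing.hasUniformization C f) ∧
    ∀ (R : Type*) [PartialOrder R], IsSuslinTree R →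
      Forcing.Forced (Forcing.isSuslinTree (UniformizingPoset C f) R) :=
  ⟨UniformizingPoset.isCCC, UniformizingPoset.mk_eq, UniformizingPoset.forced_hasUniformization,
    fun _ _ hR p => ⟨Forcing.forced_isTree hR p,
      Forcing.forced_heightOmega1 hR (UniformizingPoset.forced_omega1Preserved p),
      Forcing.forced_levelsCountable hR p, UniformizingPoset.forced_chainsCountable hR p,
      UniformizingPoset.forced_antichainsCountable hR p⟩⟩
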